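/- Let $X=\mathbb R^{M\times N}$ be the space of images on an $M\times N$ grid, $Y=X^2$, both with the Euclidean scalar product; let $\nabla=(\nabla_1,\nabla_2):X\to Y$ be the forward-difference gradient with homogeneous Neumann boundary conditions, $\mathrm{Div}=-\nabla^*$, and $\Delta=\mathrm{Div}\,\nabla$. Let $K$ be a linear operator from $X$ to a finite-dimensional Euclidean space, $z$ an element of that space, $\mu\ge 0$, $\alpha>0$, $f=K^*z$, and assume that $H=-\mu\Delta+K^*K$ is positive definite. Consider the anisotropic TV problem $$\min_{u\in X} D(u)+\alpha\|\nabla u\|_1,\qquad D(u)=\tfrac12\|Ku-z\|^2+\tfrac{\mu}{2}\|\nabla u\|^2,\qquad \|p\|_1=\sum_{i,j}\bigl(|(p_1)_{i,j}|+|(p_2)_{i,j}|\bigr),$$ and its dual $\max_{\lambda\in Y}-d(\lambda)$, where $d(\lambda)=\tfrac12\langle H^{-1}(\mathrm{Div}\lambda+f),\mathrm{Div}\lambda+f\rangle-\tfrac12\|z\|^2$ if all components satisfy $|(\lambda_i)_{j,l}|\le\alpha$, and $d(\lambda)=+\infty$ otherwise. Let $\mathcal X^A$ be the solution set of the dual.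 Let $l(u,p,\lambda)=D(u)+\alpha\|p\|_1+\langle\nabla u-p,\lambda\rangle$ and $T_l(u,p,\lambda)=\{(u',p',\lambda'):(u',p',-\lambda')\in\partial l(u,p,\lambda)\}$ ($\partial l$: convex subgradients in $(u,p)$, concave ones in $\lambda$). Let $0<\sigma_0\le\sigma_1\le\cdots$, $\sigma_k\to\sigma_\infty<\infty$, and put $\Phi_k(u,p)=l(u,p,\lambda^k)+\frac{\sigma_k}{2}\|\nabla u-p\|^2$. The augmented Lagrangian methods ALM-PDP, ALM-PDD and ALM-PT start from arbitrary $(u^0,p^0,\lambda^0)$. In step $k$ an inner semismooth Newton solver applied to $\min\Phi_k$ returns some $u^{k+1}$; then $p^{k+1}=S_{\alpha/\sigma_k}(\lambda^k/\sigma_k+\nabla u^{k+1})$, with $S_\tau$ the componentwise soft thresholding, and $\lambda^{k+1}=\mathcal P_\alpha(\lambda^k+\sigma_k\nabla u^{k+1})$ (PDP, PDD; $\mathcal P_\alpha$ is the componentwise projection onto $[-\alpha,\alpha]$) or $\lambda^{k+1}=\lambda^k+\sigma_k(\nabla u^{k+1}-p^{k+1})$ (PT). Nothing is required of $u^{k+1}$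 except the following stopping rules, where they are imposed (each for all $k$): (A) $\Phi_k(u^{k+1},p^{k+1})-\inf\Phi_k\le\frac{\epsilon_k^2}{2\sigma_k}$, with $\epsilon_k\ge0$, $\sum_k\epsilon_k<\infty$; (B1) $\Phi_k(u^{k+1},p^{k+1})-\inf\Phi_k\le\frac{\delta_k^2}{2\sigma_k}\|\lambda^{k+1}-\lambda^k\|^2$, with $\delta_k\ge0$, $\sum_k\delta_k<\infty$; (B2) $\mathrm{dist}(0,\partial\Phi_k(u^{k+1},p^{k+1}))\le\frac{\delta_k'}{\sigma_k}\|\lambda^{k+1}-\lambda^k\|$, with $0\le\delta_k'\to0$. A set-valued map $F$ is metrically subregular at $\bar x$ for $\bar y\in F(\bar x)$ with modulus $\kappa\ge0$ if there are neighbourhoods $U$ of $\bar x$ and $V$ of $\bar y$ with $\mathrm{dist}(x,F^{-1}(\bar y))\le\kappa\,\mathrm{dist}(\bar y,F(x)\cap V)$ for all $x\in U$. **Theorem.** Let $(u^k,p^k,\lambda^k)$ be generated by ALM-PDP, ALM-PDD or ALM-PT under rule (A). Then this sequence is bounded and converges to some $(u^*,p^*,\lambda^*)$, where $u^*$ solves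 the primal problem, $p^*=\nabla u^*$ and $\lambda^*\in\mathcal X^A$. If moreover $\partial d$ is metrically subregular at $\lambda^*$ for the origin with modulus $\kappa_d$ and (B1) holds, then for all sufficiently large $k$ $$\mathrm{dist}(\lambda^{k+1},\mathcal X^A)\le\theta_k\,\mathrm{dist}(\lambda^k,\mathcal X^A),\qquad \theta_k=\frac{\kappa_d(\kappa_d^2+\sigma_k^2)^{-1/2}+\delta_k}{1-\delta_k}\longrightarrow\theta_\infty=\frac{\kappa_d}{\sqrt{\kappa_d^2+\sigma_\infty^2}}<1 .$$ If in addition $T_l$ is metrically subregular at $(u^*,p^*,\lambda^*)$ for the origin with modulus $\kappa_l$ and (B2) holds, then for all sufficiently large $k$ $$\|(u^{k+1},p^{k+1})-(u^*,p^*)\|\le\theta_k'\,\|\lambda^{k+1}-\lambda^k\|,\qquad \theta_k'=\frac{\kappa_l(1+\delta_k')}{\sigma_k}\longrightarrow\frac{\kappa_l}{\sigma_\infty}.$$ -/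

import Mathlib

open Filter Topology

noncomputable section

namespace TV

/-! ### Set-valued maps, subdifferentials, metric subregularity -/

section Abstract

variable {E F : Type*} [NormedAddCommGroup E] [InnerProductSpace ℝ E] [NormedAddCommGroup F]

/-- The convex subdifferential `∂f(x)` of an extended-real-valued function; it is empty where `f`
is not finite. -/
def subdifferential (f : E → EReal) (x : E) : Set E :=
  {v | f x ≠ ⊤ ∧ f x ≠ ⊥ ∧ ∀ y, f x + ((inner ℝ v (y - x) : ℝ) : EReal) ≤ f y}

/-- `F` is metrically subregular at `x₀` for `y₀` with modulus `κ`: `(x₀, y₀)` lies in the graph of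
`F` and, for some neighbourhoods `U` of `x₀` and `V` of `y₀`,
`dist (x, F⁻¹(y₀)) ≤ κ * dist (y₀, F(x) ∩ V)` for all `x ∈ U`. The right-hand distance is an
infimum over `F(x) ∩ V` (it is `+∞` if that set is empty), so the inequality is written for each
`y ∈ F(x) ∩ V`. -/
def IsMetricallySubregularAt (T : E → Set F) (x₀ : E) (y₀ : F) (κ : ℝ) : Prop :=
  0 ≤ κ ∧ y₀ ∈ T x₀ ∧ ∃ U ∈ 𝓝 x₀, ∃ V ∈ 𝓝 y₀, ∀ x ∈ U, ∀ y ∈ T x ∩ V,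
    Metric.infDist x {x' | y₀ ∈ T x'} ≤ κ * dist y₀ y

end Abstract

/-! ### Discrete images -/

/-- Images `u : Ω → ℝ` on the `M × N` grid, with the `L²` scalar product. -/
abbrev Img (M N : ℕ) : Type := EuclideanSpace ℝ (Fin M × Fin N)

/-- `Y = X²` with the product scalar product; `p (0, i, j)` and `p (1, i, j)` are the two
components of `p` at the pixel `(i, j)`. -/
abbrev Fld (M N : ℕ) : Type := EuclideanSpace ℝ (Fin 2 × Fin M × Fin N)

/-- The space of pairs `(u, p)`, with the Euclidean norm. -/
abbrev Pair (M N : ℕ) : Type := WithLp 2 (Img M N × Fld M N)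

/-- The space of triples `(u, p, λ)`, with the Euclidean norm. -/
abbrev Triple (M N : ℕ) : Type := WithLp 2 (Pair M N × Fld M N)

/-- The pair `(u, p)`. -/
def pair {M N : ℕ} (u : Img M N) (p : Fld M N) : Pair M N := WithLp.toLp 2 (u, p)

/-- The triple `(u, p, λ)`. -/
def triple {M N : ℕ} (u : Img M N) (p lam : Fld M N) : Triple M N :=
  WithLp.toLp 2 (pair u p, lam)

/-- Forward differences with homogeneous Neumann boundary conditions. -/
def forwardDiff {M N : ℕ} (u : Img M N) : Fin 2 × Fin M × Fin N → ℝ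
  | (0, i, j) => if h : (i : ℕ) + 1 < M then u (⟨(i : ℕ) + 1, h⟩, j) - u (i, j) else 0
  | (1, i, j) => if h : (j : ℕ) + 1 < N then u (i, ⟨(j : ℕ) + 1, h⟩) - u (i, j) else 0

/-- The discrete gradient `∇ : X → Y`. -/
def grad (M N : ℕ) : Img M N →ₗ[ℝ] Fld M N where
  toFun u := WithLp.toLp 2 (forwardDiff u)
  map_add' u v := by
    ext ⟨a, i, j⟩
    match a with
    | 0 =>
      by_cases h : (i : ℕ) + 1 < M
      · simp [forwardDiff, h]; ring
      · simp [forwardDiff, h]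
    | 1 =>
      by_cases h : (j : ℕ) + 1 < N
      · simp [forwardDiff, h]; ring
      · simp [forwardDiff, h]
  map_smul' c u := by
    ext ⟨a, i, j⟩
    match a with
    | 0 =>
      by_cases h : (i : ℕ) + 1 < M
      · simp [forwardDiff, h]; ring
      · simp [forwardDiff, h]
    | 1 =>
      by_cases h : (j : ℕ) + 1 < N
      · simp [forwardDiff, h]; ring
      · simp [forwardDiff, h]

/-- The discrete divergence `Div = -∇*`. -/
def div (M N : ℕ) : Fld M N →ₗ[ℝ] Img M N := -LinearMap.adjoint (grad M N)

/-- The anisotropic norm `‖p‖₁`, the sum of `|p₁| + |p₂|` over all pixels. -/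
def l1 {M N : ℕ} (p : Fld M N) : ℝ := ∑ q, |p q|

/-- The anisotropic feasible set `{λ : ‖λ₁‖_∞ ≤ α, ‖λ₂‖_∞ ≤ α}`. -/
def box (M N : ℕ) (α : ℝ) : Set (Fld M N) := {lam | ∀ q, |lam q| ≤ α}

open Classical in
/-- The indicator function (`0` on the set, `+∞` off it). -/
def indicatorFn {E : Type*} (s : Set E) (x : E) : EReal := if x ∈ s then 0 else ⊤

/-- The componentwise projection `𝒫_α`. -/
def proj {M N : ℕ} (α : ℝ) (lam : Fld M N) : Fld M N :=
  WithLp.toLp 2 fun q => lam q / max 1 (|lam q| / α)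

/-- The componentwise soft thresholding operator `S_τ`. -/
def softThreshold {M N : ℕ} (τ : ℝ) (x : Fld M N) : Fld M N :=
  WithLp.toLp 2 fun q => if τ < x q then x q - τ else if x q < -τ then x q + τ else 0

/-! ### The anisotropic TV problem and its dual -/

/-- The data of `min_u ½‖Ku - z‖² + (μ/2)‖∇u‖² + α‖∇u‖₁`. -/
structure Problem (M N : ℕ) (Z : Type*) [NormedAddCommGroup Z] [InnerProductSpace ℝ Z] where
  /-- the linear operator `K` -/
  K : Img M N →ₗ[ℝ] Z
  /-- the known data -/
  z : Z
  /-- the weight of the quadratic regularization -/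
  μ : ℝ
  /-- the weight of the total variation -/
  α : ℝ

namespace Problem

variable {M N : ℕ} {Z : Type*} [NormedAddCommGroup Z] [InnerProductSpace ℝ Z]

/-- `D(u) = ½‖Ku - z‖² + (μ/2)‖∇u‖²`. -/
def D (P : Problem M N Z) (u : Img M N) : ℝ :=
  ‖P.K u - P.z‖ ^ 2 / 2 + P.μ / 2 * ‖grad M N u‖ ^ 2

/-- The primal objective `D(u) + α‖∇u‖₁`. -/
def primal (P : Problem M N Z) (u : Img M N) : ℝ := P.D u + P.α * l1 (grad M N u)

/-- The Lagrangian `l(u, p, λ) = D(u) + α‖p‖₁ + ⟨∇u - p, λ⟩`. -/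
def lagrangian (P : Problem M N Z) (x : Pair M N) (lam : Fld M N) : ℝ :=
  P.D x.fst + P.α * l1 x.snd + inner ℝ (grad M N x.fst - x.snd) lam

/-- The augmented Lagrangian `Φ(u, p) = l(u, p, λ) + (σ/2)‖∇u - p‖²`. -/
def augLagrangian (P : Problem M N Z) (σ : ℝ) (lam : Fld M N) (x : Pair M N) : ℝ :=
  P.lagrangian x lam + σ / 2 * ‖grad M N x.fst - x.snd‖ ^ 2

/-- `T_l(u, p, λ) = {(u', p', λ') | (u', p', -λ') ∈ ∂l(u, p, λ)}`, where `∂l` consists of the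
convex subgradients in `(u, p)` and the concave subgradients in `λ`. -/
def Tl (P : Problem M N Z) (x : Triple M N) : Set (Triple M N) :=
  {w | (∀ y : Pair M N,
          P.lagrangian x.fst x.snd + inner ℝ w.fst (y - x.fst) ≤ P.lagrangian y x.snd) ∧
       (∀ η : Fld M N,
          P.lagrangian x.fst η ≤ P.lagrangian x.fst x.snd + inner ℝ (-w.snd) (η - x.snd))}

variable [FiniteDimensional ℝ Z]

/-- `f = K*z`. -/
def f (P : Problem M N Z) : Img M N := LinearMap.adjoint P.K P.z

/-- `H = -μΔ + K*K`, where `Δ = Div ∇`. -/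
def H (P : Problem M N Z) : Module.End ℝ (Img M N) :=
  -(P.μ • (div M N ∘ₗ grad M N)) + LinearMap.adjoint P.K ∘ₗ P.K

/-- The dual objective
`d(λ) = ½‖Div λ + f‖²_{H⁻¹} - ½‖z‖² + 𝓘_{‖λ‖_∞ ≤ α}(λ)`, with `‖v‖²_{H⁻¹} = ⟨H⁻¹v, v⟩`. Here
`Ring.inverse` is the inverse in the ring of endomorphisms. -/
def d (P : Problem M N Z) (lam : Fld M N) : EReal :=
  ((1 / 2 * inner ℝ (Ring.inverse P.H (div M N lam + P.f)) (div M N lam + P.f)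
      - 1 / 2 * ‖P.z‖ ^ 2 : ℝ) : EReal) + indicatorFn (box M N P.α) lam

/-- The solution set `𝒳^A` of the dual problem `max_λ -d(λ)`. -/
def dualSolutions (P : Problem M N Z) : Set (Fld M N) := {lam | ∀ η, P.d lam ≤ P.d η}

end Problem

/-! ### The augmented Lagrangian method -/

/-- The three methods: the subproblem is treated by the primal-dual semismooth Newton method
solving for the primal variable first (`PDP`) or for the dual variable first (`PDD`), or by the
semismooth Newton method with soft thresholding (`PT`). -/
inductive Variant
  | PDP
  | PDD
  | PT

variable {M N : ℕ} {Z : Type*} [NormedAddCommGroup Z] [InnerProductSpace ℝ Z]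

/-- The multiplier update: `λ⁺ = 𝒫_α(λ + σ∇u⁺)` for `PDP` and `PDD`, and
`λ⁺ = λ + σ(∇u⁺ - p⁺)` for `PT`. -/
def multiplierUpdate (P : Problem M N Z) (σ : ℝ) (lam : Fld M N) (u' : Img M N) (p' : Fld M N) :
    Variant → Fld M N
  | .PDP => proj P.α (lam + σ • grad M N u')
  | .PDD => proj P.α (lam + σ • grad M N u')
  | .PT => lam + σ • (grad M N u' - p')

/-- `(u^k, p^k, λ^k)` is a sequence of iterates of the augmented Lagrangian method with positive,
nondecreasing step sizes `σ_k → σ_∞ < ∞`. The component `u^{k+1}` is whatever the inner Newton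
solver returns for the `k`-th subproblem when it is stopped: apart from the stopping criteria
below nothing is required of it, so that every run of the three methods (with any initial values,
any accuracy of the linear solves and any line search) is such a sequence. -/
structure IsALMSequence (P : Problem M N Z) (v : Variant) (σ : ℕ → ℝ) (σinf : ℝ)
    (u : ℕ → Img M N) (p lam : ℕ → Fld M N) : Prop where
  sigma_pos : ∀ k, 0 < σ k
  sigma_mono : Monotone σ
  sigma_tendsto : Tendsto σ atTop (𝓝 σinf)
  p_update : ∀ k, p (k + 1) =
    softThreshold (P.α / σ k) ((σ k)⁻¹ • lam k + grad M N (u (k + 1)))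
  lam_update : ∀ k, lam (k + 1) = multiplierUpdate P (σ k) (lam k) (u (k + 1)) (p (k + 1)) v

/-- `Φ_k(u^{k+1}, p^{k+1}) - inf Φ_k`. -/
def subproblemGap (P : Problem M N Z) (σ : ℕ → ℝ) (u : ℕ → Img M N) (p lam : ℕ → Fld M N)
    (k : ℕ) : ℝ :=
  P.augLagrangian (σ k) (lam k) (pair (u (k + 1)) (p (k + 1)))
    - ⨅ x : Pair M N, P.augLagrangian (σ k) (lam k) x

/-- Criterion (A). -/
def StopA (P : Problem M N Z) (σ : ℕ → ℝ) (u : ℕ → Img M N) (p lam : ℕ → Fld M N)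
    (ε : ℕ → ℝ) : Prop :=
  (∀ k, 0 ≤ ε k) ∧ Summable ε ∧ ∀ k, subproblemGap P σ u p lam k ≤ ε k ^ 2 / (2 * σ k)

/-- Criterion (B1). -/
def StopB1 (P : Problem M N Z) (σ : ℕ → ℝ) (u : ℕ → Img M N) (p lam : ℕ → Fld M N)
    (δ : ℕ → ℝ) : Prop :=
  (∀ k, 0 ≤ δ k) ∧ Summable δ ∧
    ∀ k, subproblemGap P σ u p lam k ≤ δ k ^ 2 / (2 * σ k) * ‖lam (k + 1) - lam k‖ ^ 2

/-- Criterion (B2). -/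
def StopB2 (P : Problem M N Z) (σ : ℕ → ℝ) (u : ℕ → Img M N) (p lam : ℕ → Fld M N)
    (δ' : ℕ → ℝ) : Prop :=
  (∀ k, 0 ≤ δ' k) ∧ Tendsto δ' atTop (𝓝 0) ∧
    ∀ k, Metric.infDist 0
        (subdifferential (fun x => (P.augLagrangian (σ k) (lam k) x : EReal))
          (pair (u (k + 1)) (p (k + 1))))
      ≤ δ' k / σ k * ‖lam (k + 1) - lam k‖

/-- The rate `θ = [κ(κ² + σ²)^{-1/2} + δ](1 - δ)⁻¹`. -/
def rate (κ σ δ : ℝ) : ℝ := (κ / √(κ ^ 2 + σ ^ 2) + δ) * (1 - δ)⁻¹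

end TV

end

/-! The method is an inexact proximal point iteration for the dual. By Moreau's decomposition
(`proj_eq_sub_softThreshold`) the three multiplier updates coincide. Let b_k be the proximal point
of λ^k for d with step σ_k. From b_k one builds an exact minimizer of Φ_k, and expanding Φ_k around
it (`IsProx.gap`) bounds both ‖λ^{k+1} - b_k‖²/(2σ_k) and the H-energy of u^{k+1} - `primalOf b_k`
by the subproblem gap. Under (A), Fejér monotonicity with summable errors
(`exists_tendsto_of_fejer`) makes λ^k converge; the energy bound then gives u^k, and p^k follows
from the update.

For the dual rate, (λ^k - b_k)/σ_k is a subgradient of d at b_k, so subregularity bounds dist(b_k,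
𝒳^A) by κ_d‖λ^k - b_k‖/σ_k; the Fejér inequality turns this into a contraction and (B1) absorbs the
error (`infDist_le_rate_mul`).

For the primal rate, a subgradient v of Φ_k at the new iterate yields the element (v, -(∇u^{k+1} -
p^{k+1})) of T_l at (u^{k+1}, p^{k+1}, λ^{k+1}). Its norm is controlled by (B2), and all zeros of
T_l share the same primal part (`fst_eq_of_zero_mem_Tl`). -/

noncomputable section

namespace TV

/-! ### The box, the ℓ¹ norm, projection and soft thresholding -/

section Box

variable {M N : ℕ}

theorem inner_fld (p q : Fld M N) : inner ℝ p q = ∑ i, p i * q i := by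
  simp [PiLp.inner_apply, mul_comm]

theorem inner_div_left (l : Fld M N) (u : Img M N) :
    inner ℝ (div M N l) u = -inner ℝ l (grad M N u) := by
  simp [div, LinearMap.adjoint_inner_left]

theorem zero_mem_box {α : ℝ} (hα : 0 < α) : (0 : Fld M N) ∈ box M N α := by
  intro q; simpa using hα.le

theorem convex_box (α : ℝ) : Convex ℝ (box M N α) := by
  intro x hx y hy a b ha hb hab q
  calc |(a • x + b • y) q| ≤ |a * x q| + |b * y q| := by
        simpa using abs_add_le (a * x q) (b * y q)
    _ = a * |x q| + b * |y q| := by rw [abs_mul, abs_mul, abs_of_nonneg ha, abs_of_nonneg hb]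
    _ ≤ a * α + b * α := by
        gcongr
        · exact hx q
        · exact hy q
    _ = α := by rw [← add_mul, hab, one_mul]

theorem isClosed_box (α : ℝ) : IsClosed (box M N α) := by
  simp only [box, Set.ofPred_forall]
  exact isClosed_iInter fun q => isClosed_le (by fun_prop) continuous_const

theorem isCompact_box (α : ℝ) : IsCompact (box M N α) := by
  refine Metric.isCompact_of_isClosed_isBounded (isClosed_box α) ?_
  refine isBounded_iff_forall_norm_le.2 ⟨√(∑ _q : Fin 2 × Fin M × Fin N, α ^ 2), fun x hx => ?_⟩
  rw [EuclideanSpace.norm_eq]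
  refine Real.sqrt_le_sqrt (Finset.sum_le_sum fun q _ => ?_)
  rw [Real.norm_eq_abs]
  exact pow_le_pow_left₀ (abs_nonneg _) (hx q) 2

theorem inner_le_l1 {α : ℝ} (p : Fld M N) {l : Fld M N} (hl : l ∈ box M N α) :
    inner ℝ p l ≤ α * l1 p := by
  rw [inner_fld, l1, Finset.mul_sum]
  refine Finset.sum_le_sum fun q _ => (le_abs_self _).trans ?_
  rw [abs_mul, mul_comm]
  exact mul_le_mul_of_nonneg_right (hl q) (abs_nonneg _)

/-- A normal vector of the box at `l` attains equality in `inner_le_l1`. -/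
theorem inner_eq_l1 {α : ℝ} (hα : 0 < α) {p l : Fld M N} (hl : l ∈ box M N α)
    (h : ∀ η ∈ box M N α, inner ℝ p (η - l) ≤ 0) : inner ℝ p l = α * l1 p := by
  refine le_antisymm (inner_le_l1 p hl) ?_
  -- The vertex α·sign(p) maximizes ⟨p, ·⟩ over the box.
  have hs : (WithLp.toLp 2 fun q => α * SignType.sign (p q) : Fld M N) ∈ box M N α := by
    intro q
    rcases lt_trichotomy (p q) 0 with h | h | h <;> simp [h, abs_of_pos hα, hα.le]
  have := h _ hs
  rw [inner_sub_right, inner_fld] at this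
  have h2 : ∑ q, p q * (α * (SignType.sign (p q) : ℝ)) = α * l1 p := by
    rw [l1, Finset.mul_sum]
    refine Finset.sum_congr rfl fun q _ => ?_
    rw [← self_mul_sign]; ring
  simp only at this
  linarith

theorem l1_smul_add_smul_le (a b : ℝ) (ha : 0 ≤ a) (hb : 0 ≤ b) (p q : Fld M N) :
    l1 (a • p + b • q) ≤ a * l1 p + b * l1 q := by
  simp only [l1, Finset.mul_sum, ← Finset.sum_add_distrib]
  refine Finset.sum_le_sum fun i _ => ?_
  calc |(a • p + b • q) i| ≤ |a * p i| + |b * q i| := by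
        simpa using abs_add_le (a * p i) (b * q i)
    _ = _ := by rw [abs_mul, abs_mul, abs_of_nonneg ha, abs_of_nonneg hb]

/-- Moreau's decomposition: projection and shrinkage are proximal maps of conjugate functions.
Coordinatewise, the cases compare σx with ±α, where x = σ⁻¹l + g. -/
theorem proj_eq_sub_softThreshold {α σ : ℝ} (hα : 0 < α) (hσ : 0 < σ) (l g : Fld M N) :
    proj α (l + σ • g) = l + σ • (g - softThreshold (α / σ) (σ⁻¹ • l + g)) := by
  ext q
  have e : l q + σ * g q = σ * (σ⁻¹ • l + g) q := by
    simp only [PiLp.add_apply, PiLp.smul_apply, smul_eq_mul]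
    field_simp
  generalize σ⁻¹ • l + g = x at e
  simp only [proj, softThreshold, PiLp.add_apply, PiLp.sub_apply, PiLp.smul_apply, smul_eq_mul]
  rw [mul_sub, ← add_sub_assoc, e]
  split_ifs with h1 h2
  · have h : α < σ * x q := (div_lt_iff₀' hσ).1 h1
    rw [abs_of_pos (hα.trans h), max_eq_right ((one_le_div hα).2 h.le)]
    rw [div_div_cancel₀ (hα.trans h).ne']
    field_simp
    ring
  · have h : σ * x q < -α := by
      rw [← neg_div] at h2
      exact (lt_div_iff₀' hσ).1 h2
    have h0 : σ * x q < 0 := by linarith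
    rw [abs_of_neg h0, max_eq_right ((one_le_div hα).2 (by linarith))]
    rw [neg_div, div_neg, div_div_cancel₀ h0.ne]
    field_simp
    ring
  · have h : |σ * x q| ≤ α := by
      rw [← neg_div] at h2
      exact abs_le.2 ⟨(div_le_iff₀' hσ).1 (not_lt.1 h2), (le_div_iff₀' hσ).1 (not_lt.1 h1)⟩
    rw [max_eq_left ((div_le_one hα).2 h), div_one, mul_zero, sub_zero]

theorem proj_mem_box {α : ℝ} (hα : 0 < α) (l : Fld M N) : proj α l ∈ box M N α := by
  intro q
  have h : 0 < max 1 (|l q| / α) := lt_max_of_lt_left one_pos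
  simp only [proj, abs_div, abs_of_pos h]
  rw [div_le_iff₀ h]
  calc |l q| = α * (|l q| / α) := by field_simp
    _ ≤ _ := by gcongr; exact le_max_right _ _

/-- Where the thresholded value is nonzero, the projection is α times its sign. Hence λ^{k+1} ∈
α∂‖·‖₁(p^{k+1}) holds exactly, however inexact u^{k+1} is. -/
theorem inner_softThreshold {α σ : ℝ} (hα : 0 < α) (hσ : 0 < σ) (l g : Fld M N) :
    inner ℝ (softThreshold (α / σ) (σ⁻¹ • l + g)) (proj α (l + σ • g)) =
      α * l1 (softThreshold (α / σ) (σ⁻¹ • l + g)) := by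
  rw [inner_fld, l1, Finset.mul_sum]
  refine Finset.sum_congr rfl fun q _ => ?_
  rw [proj_eq_sub_softThreshold hα hσ]
  have e : l q + σ * g q = σ * (σ⁻¹ • l + g) q := by
    simp only [PiLp.add_apply, PiLp.smul_apply, smul_eq_mul]
    field_simp
  generalize σ⁻¹ • l + g = x at e
  simp only [softThreshold, PiLp.add_apply, PiLp.sub_apply, PiLp.smul_apply, smul_eq_mul]
  rw [mul_sub, ← add_sub_assoc, e]
  have h0 : 0 < α / σ := div_pos hα hσ
  have hm : σ * (α / σ) = α := by field_simp
  split_ifs with h1 h2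
  · rw [abs_of_pos (sub_pos.2 h1), ← mul_sub, sub_sub_cancel, hm, mul_comm]
  · rw [abs_of_neg (by linarith), mul_add, hm]
    ring
  · simp

end Box

/-- The multiplier updates of the three methods agree. -/
theorem multiplierUpdate_eq {M N : ℕ} {Z : Type*} [NormedAddCommGroup Z] [InnerProductSpace ℝ Z]
    (P : Problem M N Z) (hα : 0 < P.α) {σ : ℝ} (hσ : 0 < σ) (lam : Fld M N) (u' : Img M N)
    (v : Variant) :
    multiplierUpdate P σ lam u' (softThreshold (P.α / σ) (σ⁻¹ • lam + grad M N u')) v =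
      proj P.α (lam + σ • grad M N u') := by
  cases v
  · rfl
  · rfl
  · exact (proj_eq_sub_softThreshold hα hσ _ _).symm

@[simp]
theorem pair_fst {M N : ℕ} (u : Img M N) (p : Fld M N) : (pair u p).fst = u := rfl

@[simp]
theorem pair_snd {M N : ℕ} (u : Img M N) (p : Fld M N) : (pair u p).snd = p := rfl

/-! ### Quadratic expansions of the Lagrangian, the data term and the dual objective -/

namespace Problem

variable {M N : ℕ} {Z : Type*} [NormedAddCommGroup Z] [InnerProductSpace ℝ Z]

theorem lagrangian_def (P : Problem M N Z) (u : Img M N) (p l : Fld M N) :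
    P.lagrangian (pair u p) l = P.D u + P.α * l1 p + inner ℝ (grad M N u - p) l := rfl

/-- The augmented Lagrangian for `lam` and the Lagrangian for the updated multiplier differ by a
constant and a quadratic remainder. -/
theorem augLagrangian_sub (P : Problem M N Z) {σ : ℝ} {lam l : Fld M N} (x y : Pair M N)
    (hl : l = lam + σ • (grad M N x.fst - x.snd)) :
    P.augLagrangian σ lam y - P.augLagrangian σ lam x =
      P.lagrangian y l - P.lagrangian x l +
        σ / 2 * ‖(grad M N y.fst - y.snd) - (grad M N x.fst - x.snd)‖ ^ 2 := by
  subst hl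
  simp only [augLagrangian, lagrangian]
  rw [norm_sub_sq_real (grad M N y.fst - y.snd), inner_add_right, inner_add_right, inner_smul_right, inner_smul_right,
    real_inner_self_eq_norm_sq]
  ring

variable [FiniteDimensional ℝ Z]

theorem inner_H (P : Problem M N Z) (u w : Img M N) :
    inner ℝ (P.H u) w =
      inner ℝ (P.K u) (P.K w) + P.μ * inner ℝ (grad M N u) (grad M N w) := by
  simp [H, inner_add_left, inner_smul_left, inner_div_left, LinearMap.adjoint_inner_left]
  ring

theorem inner_H_comm (P : Problem M N Z) (u w : Img M N) :
    inner ℝ (P.H u) w = inner ℝ u (P.H w) := by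
  rw [real_inner_comm (P.H w) u, inner_H, inner_H, real_inner_comm (P.K w),
    real_inner_comm (grad M N w)]

theorem D_eq (P : Problem M N Z) (u w : Img M N) :
    P.D w = P.D u + inner ℝ (P.H u - P.f) (w - u) + 1 / 2 * inner ℝ (P.H (w - u)) (w - u) := by
  simp only [D, inner_sub_left, inner_H, f, LinearMap.adjoint_inner_left, map_sub]
  have e : P.K w - P.z = (P.K u - P.z) + (P.K w - P.K u) := by abel
  have e' : grad M N w = grad M N u + (grad M N w - grad M N u) := by abel
  rw [e, norm_add_sq_real]
  nth_rewrite 1 [e']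
  rw [norm_add_sq_real, inner_sub_left (P.K u) P.z,
    ← real_inner_self_eq_norm_sq (P.K w - P.K u),
    ← real_inner_self_eq_norm_sq (grad M N w - grad M N u), inner_sub_left (P.K w) (P.K u),
    inner_sub_left (grad M N w) (grad M N u)]
  ring

theorem isUnit_H (P : Problem M N Z) (hH : ∀ u : Img M N, u ≠ 0 → 0 < inner ℝ (P.H u) u) :
    IsUnit P.H := by
  rw [LinearMap.isUnit_iff_ker_eq_bot, LinearMap.ker_eq_bot']
  intro u hu
  by_contra h
  have := hH u h
  simp [hu] at this

theorem inner_H_self_nonneg (P : Problem M N Z)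
    (hH : ∀ u : Img M N, u ≠ 0 → 0 < inner ℝ (P.H u) u) (u : Img M N) :
    0 ≤ inner ℝ (P.H u) u := by
  by_cases h : u = 0
  · simp [h]
  · exact (hH u h).le

/-- The primal point `H⁻¹(Div λ + f)` belonging to a dual variable `λ`. -/
def primalOf (P : Problem M N Z) (l : Fld M N) : Img M N := Ring.inverse P.H (div M N l + P.f)

/-- The smooth part of the dual objective. -/
def dualQuad (P : Problem M N Z) (l : Fld M N) : ℝ :=
  1 / 2 * inner ℝ (P.primalOf l) (div M N l + P.f) - 1 / 2 * ‖P.z‖ ^ 2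

theorem d_of_mem (P : Problem M N Z) {l : Fld M N} (hl : l ∈ box M N P.α) :
    P.d l = (P.dualQuad l : EReal) := by
  simp [d, indicatorFn, hl, dualQuad, primalOf]

theorem d_of_notMem (P : Problem M N Z) {l : Fld M N} (hl : l ∉ box M N P.α) : P.d l = ⊤ := by
  rw [d, indicatorFn, if_neg hl, EReal.coe_add_top]

theorem continuous_primalOf (P : Problem M N Z) : Continuous P.primalOf := by
  have h1 : Continuous (div M N) := LinearMap.continuous_of_finiteDimensional _
  have h2 : Continuous (Ring.inverse P.H : Img M N →ₗ[ℝ] Img M N) :=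
    LinearMap.continuous_of_finiteDimensional _
  exact h2.comp (h1.add continuous_const)

theorem continuous_dualQuad (P : Problem M N Z) : Continuous P.dualQuad := by
  have h1 : Continuous (div M N) := LinearMap.continuous_of_finiteDimensional _
  have h2 := P.continuous_primalOf
  unfold dualQuad
  fun_prop

theorem mem_dualSolutions_iff (P : Problem M N Z) (hα : 0 < P.α) {l : Fld M N} :
    l ∈ P.dualSolutions ↔
      l ∈ box M N P.α ∧ ∀ η ∈ box M N P.α, P.dualQuad l ≤ P.dualQuad η := by
  constructor
  · intro h
    have hl : l ∈ box M N P.α := by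
      by_contra hl
      have h0 := h 0
      rw [d_of_notMem P hl, d_of_mem P (zero_mem_box hα)] at h0
      exact EReal.coe_ne_top _ (top_le_iff.1 h0)
    refine ⟨hl, fun η hη => ?_⟩
    have h0 := h η
    rwa [d_of_mem P hl, d_of_mem P hη, EReal.coe_le_coe_iff] at h0
  · rintro ⟨hl, h⟩ η
    by_cases hη : η ∈ box M N P.α
    · rw [d_of_mem P hl, d_of_mem P hη, EReal.coe_le_coe_iff]
      exact h η hη
    · rw [d_of_notMem P hη]
      exact le_top

theorem dualSolutions_nonempty (P : Problem M N Z) (hα : 0 < P.α) :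
    P.dualSolutions.Nonempty := by
  obtain ⟨s, hs, h⟩ := (isCompact_box P.α).exists_isMinOn ⟨0, zero_mem_box hα⟩
    P.continuous_dualQuad.continuousOn
  exact ⟨s, (P.mem_dualSolutions_iff hα).2 ⟨hs, fun η hη => h hη⟩⟩

theorem setOf_zero_mem_subdifferential_d (P : Problem M N Z) (hα : 0 < P.α) :
    {l | (0 : Fld M N) ∈ subdifferential P.d l} = P.dualSolutions := by
  ext l
  simp only [subdifferential, inner_zero_left, EReal.coe_zero, add_zero, Set.mem_ofPred_eq]
  refine ⟨fun h => h.2.2, fun h => ?_⟩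
  have hl := ((P.mem_dualSolutions_iff hα).1 h).1
  rw [d_of_mem P hl]
  refine ⟨EReal.coe_ne_top _, EReal.coe_ne_bot _, fun y => ?_⟩
  rw [← d_of_mem P hl]
  exact h y

section PosDef

variable (P : Problem M N Z) (hH : ∀ u : Img M N, u ≠ 0 → 0 < inner ℝ (P.H u) u)
include hH

theorem H_primalOf (l : Fld M N) : P.H (P.primalOf l) = div M N l + P.f := by
  have := Ring.mul_inverse_cancel _ (P.isUnit_H hH)
  exact LinearMap.congr_fun this _

/-- Exact Taylor expansion: the gradient at `l` is -∇(`primalOf l`), and the second-order term is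
the H-energy between the primal points. -/
theorem dualQuad_eq (l η : Fld M N) :
    P.dualQuad η = P.dualQuad l - inner ℝ (grad M N (P.primalOf l)) (η - l) +
      1 / 2 * inner ℝ (P.H (P.primalOf η - P.primalOf l)) (P.primalOf η - P.primalOf l) := by
  have h1 : inner ℝ (grad M N (P.primalOf l)) (η - l) =
      -(inner ℝ (P.primalOf l) (P.H (P.primalOf η)) -
        inner ℝ (P.primalOf l) (P.H (P.primalOf l))) := by
    rw [← inner_sub_right, P.H_primalOf hH, P.H_primalOf hH, add_sub_add_right_eq_sub, ← map_sub,
      real_inner_comm, real_inner_comm (div M N _), inner_div_left, neg_neg]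
  rw [h1]
  simp only [dualQuad, ← P.H_primalOf hH, map_sub, inner_sub_left, inner_sub_right,
    inner_H_comm]
  have h2 := P.inner_H_comm (P.primalOf l) (P.primalOf η)
  rw [real_inner_comm] at h2
  rw [h2]
  ring

theorem dualQuad_ge (l η : Fld M N) :
    P.dualQuad l - inner ℝ (grad M N (P.primalOf l)) (η - l) ≤ P.dualQuad η := by
  rw [P.dualQuad_eq hH l η]
  linarith [P.inner_H_self_nonneg hH (P.primalOf η - P.primalOf l)]

end PosDef
end Problem

/-! ### First-order conditions and Fejér monotone sequences -/

theorem nonneg_of_forall_small {A C : ℝ} (h : ∀ t : ℝ, 0 < t → t ≤ 1 → 0 ≤ t * A + t ^ 2 * C) :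
    0 ≤ A := by
  have h1 : Tendsto (fun t : ℝ => A + t * C) (𝓝[>] 0) (𝓝 A) := by
    have : Continuous fun t : ℝ => A + t * C := by fun_prop
    simpa using (this.tendsto 0).mono_left nhdsWithin_le_nhds
  refine ge_of_tendsto h1 ?_
  filter_upwards [Ioc_mem_nhdsGT (zero_lt_one' ℝ)] with t ht
  have h2 := h t ht.1 ht.2
  have h3 : t * A + t ^ 2 * C = t * (A + t * C) := by ring
  rw [h3] at h2
  exact nonneg_of_mul_nonneg_right h2 ht.1

/-- Convergence of the inexact proximal point iteration: `b k` is a firmly nonexpansive step from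
`a k` and `a (k + 1)` approximates it with summable errors. -/
theorem exists_tendsto_of_fejer {E : Type*} [NormedAddCommGroup E] [ProperSpace E]
    {a b : ℕ → E} {e : ℕ → ℝ} {S : Set E} (hS : S.Nonempty) (he : Summable e)
    (he0 : ∀ k, 0 ≤ e k) (hab : ∀ k, ‖a (k + 1) - b k‖ ≤ e k)
    (hf : ∀ s ∈ S, ∀ k, ‖b k - s‖ ^ 2 + ‖a k - b k‖ ^ 2 ≤ ‖a k - s‖ ^ 2)
    (hc : ∀ (φ : ℕ → ℕ) (x : E), StrictMono φ → Tendsto (a ∘ φ) atTop (𝓝 x) →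
      Tendsto (b ∘ φ) atTop (𝓝 x) → x ∈ S) :
    ∃ x ∈ S, Tendsto a atTop (𝓝 x) ∧ Tendsto b atTop (𝓝 x) := by
  have hbs : ∀ s ∈ S, ∀ k, ‖b k - s‖ ≤ ‖a k - s‖ := fun s hs k =>
    le_of_sq_le_sq (by nlinarith [hf s hs k, sq_nonneg ‖a k - b k‖]) (norm_nonneg _)
  have hstep : ∀ s ∈ S, ∀ k, ‖a (k + 1) - s‖ ≤ ‖b k - s‖ + e k := fun s hs k => by
    have := norm_add_le (a (k + 1) - b k) (b k - s)
    rw [sub_add_sub_cancel] at this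
    linarith [hab k]
  have hconv : ∀ s ∈ S, ∃ c, Tendsto (fun k => ‖a k - s‖) atTop (𝓝 c) := by
    intro s hs
    -- Subtracting the accumulated errors makes the distances to s monotone.
    have hanti : Antitone fun k => ‖a k - s‖ - ∑ j ∈ Finset.range k, e j := by
      refine antitone_nat_of_succ_le fun k => ?_
      rw [Finset.sum_range_succ]
      linarith [hbs s hs k, hstep s hs k]
    have hbdd : BddBelow (Set.range fun k => ‖a k - s‖ - ∑ j ∈ Finset.range k, e j) := by
      refine ⟨-∑' j, e j, ?_⟩
      rintro _ ⟨k, rfl⟩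
      have := he.sum_le_tsum (Finset.range k) fun j _ => he0 j
      simp only
      linarith [norm_nonneg (a k - s)]
    have h := (tendsto_atTop_ciInf hanti hbdd).add he.hasSum.tendsto_sum_nat
    simp only [sub_add_cancel] at h
    exact ⟨_, h⟩
  have hdiff : Tendsto (fun k => a k - b k) atTop (𝓝 0) := by
    obtain ⟨s, hs⟩ := hS
    obtain ⟨c, h⟩ := hconv s hs
    -- ‖b k - s‖ is squeezed between ‖a (k+1) - s‖ - e k and ‖a k - s‖, so both distances have the
    -- same limit and `hf` forces a - b → 0.
    have hb : Tendsto (fun k => ‖b k - s‖) atTop (𝓝 c) := by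
      have h1 := ((tendsto_add_atTop_iff_nat 1).2 h).sub he.tendsto_atTop_zero
      rw [sub_zero] at h1
      exact tendsto_of_tendsto_of_tendsto_of_le_of_le h1 h
        (fun k => by simp only; linarith [hstep s hs k]) (hbs s hs)
    have h2 := (h.pow 2).sub (hb.pow 2)
    rw [sub_self] at h2
    have h3 : Tendsto (fun k => ‖a k - b k‖ ^ 2) atTop (𝓝 0) :=
      squeeze_zero (fun _ => sq_nonneg _) (fun k => by linarith [hf s hs k]) h2
    rw [tendsto_zero_iff_norm_tendsto_zero]
    simpa [Real.sqrt_sq] using h3.sqrt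
  obtain ⟨x, φ, hφ, hx⟩ : ∃ x, ∃ φ : ℕ → ℕ, StrictMono φ ∧ Tendsto (a ∘ φ) atTop (𝓝 x) := by
    obtain ⟨s, hs⟩ := hS
    obtain ⟨c, h⟩ := hconv s hs
    obtain ⟨C, hC⟩ := h.bddAbove_range
    have hbd : Bornology.IsBounded (Set.range a) := by
      refine (Metric.isBounded_closedBall (x := s) (r := C)).subset ?_
      rintro _ ⟨k, rfl⟩
      rw [mem_closedBall_iff_norm]
      exact hC ⟨k, rfl⟩
    obtain ⟨x, -, φ, hφ, hx⟩ := tendsto_subseq_of_bounded hbd fun k => Set.mem_range_self k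
    exact ⟨x, φ, hφ, hx⟩
  have hbx : Tendsto (b ∘ φ) atTop (𝓝 x) := by
    have := hx.sub (hdiff.comp hφ.tendsto_atTop)
    rw [sub_zero] at this
    exact this.congr fun k => by simp
  have hxS := hc φ x hφ hx hbx
  -- The whole sequence ‖a k - x‖ converges, and a subsequence tends to 0.
  obtain ⟨c, h⟩ := hconv x hxS
  have hc0 : c = 0 :=
    tendsto_nhds_unique (h.comp hφ.tendsto_atTop) (tendsto_iff_norm_sub_tendsto_zero.1 hx)
  rw [hc0] at h
  have ha : Tendsto a atTop (𝓝 x) := tendsto_iff_norm_sub_tendsto_zero.2 h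
  refine ⟨x, hxS, ha, ?_⟩
  have := ha.sub hdiff
  simpa using this

/-! ### Proximal points of the dual objective -/

namespace Problem

variable {M N : ℕ} {Z : Type*} [NormedAddCommGroup Z] [InnerProductSpace ℝ Z]
  [FiniteDimensional ℝ Z] (P : Problem M N Z)

/-- `lb` is the proximal point `(I + σ ∂d)⁻¹ lam`, in the form of a variational inequality. -/
def IsProx (σ : ℝ) (lam lb : Fld M N) : Prop :=
  lb ∈ box M N P.α ∧ ∀ η ∈ box M N P.α,
    inner ℝ (grad M N (P.primalOf lb)) (η - lb) ≤ σ⁻¹ * inner ℝ (lb - lam) (η - lb)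

variable (hH : ∀ u : Img M N, u ≠ 0 → 0 < inner ℝ (P.H u) u)
include hH

/-- Optimality condition along segments of the box; c = σ⁻¹ gives proximal points and c = 0 gives
dual solutions. -/
theorem inner_grad_primalOf_le {c : ℝ} {lam x : Fld M N} (hx : x ∈ box M N P.α)
    (hmin : ∀ η ∈ box M N P.α,
      P.dualQuad x + c / 2 * ‖x - lam‖ ^ 2 ≤ P.dualQuad η + c / 2 * ‖η - lam‖ ^ 2)
    {η : Fld M N} (hη : η ∈ box M N P.α) :
    inner ℝ (grad M N (P.primalOf x)) (η - x) ≤ c * inner ℝ (x - lam) (η - x) := by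
  rw [← sub_nonneg]
  refine nonneg_of_forall_small (C := 1 / 2 * inner ℝ (P.H (P.primalOf η - P.primalOf x))
    (P.primalOf η - P.primalOf x) + c / 2 * ‖η - x‖ ^ 2) fun t ht0 ht1 => ?_
  have hy : x + t • (η - x) ∈ box M N P.α :=
    (convex_box P.α).add_smul_sub_mem hx hη ⟨ht0.le, ht1⟩
  have hu : P.primalOf (x + t • (η - x)) - P.primalOf x = t • (P.primalOf η - P.primalOf x) := by
    simp only [primalOf, ← map_sub, ← map_smul]
    congr 1
    simp only [map_add, map_sub, map_smul]
    module
  have h := hmin _ hy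
  rw [P.dualQuad_eq hH x (x + t • (η - x)), hu, add_sub_cancel_left, map_smul, inner_smul_left, inner_smul_right,
    inner_smul_right, add_sub_right_comm, norm_add_sq_real, inner_smul_right, norm_smul, mul_pow,
    Real.norm_eq_abs, sq_abs] at h
  simp only [conj_trivial] at h
  linarith

theorem exists_isProx (hα : 0 < P.α) {σ : ℝ} (lam : Fld M N) :
    ∃ lb, P.IsProx σ lam lb := by
  have hcont : Continuous fun η => P.dualQuad η + σ⁻¹ / 2 * ‖η - lam‖ ^ 2 := by
    have := P.continuous_dualQuad
    fun_prop
  obtain ⟨x, hx, h⟩ := (isCompact_box P.α).exists_isMinOn ⟨0, zero_mem_box hα⟩ hcont.continuousOn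
  exact ⟨x, hx, fun η hη => P.inner_grad_primalOf_le hH hx (fun η hη => h hη) hη⟩

theorem inner_grad_le_of_mem_dualSolutions (hα : 0 < P.α) {s η : Fld M N}
    (hs : s ∈ P.dualSolutions) (hη : η ∈ box M N P.α) :
    inner ℝ (grad M N (P.primalOf s)) (η - s) ≤ 0 := by
  rw [P.mem_dualSolutions_iff hα] at hs
  simpa using P.inner_grad_primalOf_le hH (c := 0) (lam := 0) hs.1
    (fun η hη => by simpa using hs.2 η hη) hη

/-- At `primalOf l` the gradient of D is Div l, which cancels the linear term ⟨∇u, l⟩. What remains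
is the H-energy and α‖·‖₁ - ⟨·, l⟩, which is nonnegative and vanishes at p. -/
theorem lagrangian_primalOf_add_le {l p : Fld M N} (hl : l ∈ box M N P.α)
    (hp : inner ℝ p l = P.α * l1 p) (y : Pair M N) :
    P.lagrangian (pair (P.primalOf l) p) l +
        1 / 2 * inner ℝ (P.H (y.fst - P.primalOf l)) (y.fst - P.primalOf l) ≤
      P.lagrangian y l := by
  rw [lagrangian_def, lagrangian, P.D_eq (P.primalOf l) y.fst, P.H_primalOf hH,
    add_sub_cancel_right, inner_div_left, map_sub (grad M N),
    real_inner_comm (grad M N y.fst - grad M N (P.primalOf l)) l,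
    inner_sub_left (grad M N (P.primalOf l)) p, inner_sub_left (grad M N y.fst) y.snd,
    inner_sub_left (grad M N y.fst) (grad M N (P.primalOf l))]
  linarith [inner_le_l1 y.snd hl]

/-- A dual solution yields the unique primal solution. -/
theorem primal_primalOf_add_le (hα : 0 < P.α) {s : Fld M N} (hs : s ∈ P.dualSolutions)
    (w : Img M N) :
    P.primal (P.primalOf s) +
        1 / 2 * inner ℝ (P.H (w - P.primalOf s)) (w - P.primalOf s) ≤ P.primal w := by
  have hsb := ((P.mem_dualSolutions_iff hα).1 hs).1
  have h := P.lagrangian_primalOf_add_le hH hsb (inner_eq_l1 hα hsb fun η hη =>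
    P.inner_grad_le_of_mem_dualSolutions hH hα hs hη) (pair w (grad M N w))
  simpa [lagrangian_def, primal] using h

theorem eq_primalOf_of_primal_le (hα : 0 < P.α) {s : Fld M N} (hs : s ∈ P.dualSolutions)
    {w : Img M N} (hw : P.primal w ≤ P.primal (P.primalOf s)) : w = P.primalOf s := by
  by_contra h
  linarith [hH _ (sub_ne_zero.2 h), P.primal_primalOf_add_le hH hα hs w]

section Prox

variable {P} {σ : ℝ} {lam lb : Fld M N} (hb : P.IsProx σ lam lb)
include hb

theorem IsProx.dualQuad_add_le {η : Fld M N} (hη : η ∈ box M N P.α) :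
    P.dualQuad lb + σ⁻¹ * inner ℝ (lam - lb) (η - lb) ≤ P.dualQuad η := by
  have h1 := hb.2 η hη
  have h2 := P.dualQuad_ge hH lb η
  rw [← neg_sub lb lam, inner_neg_left]
  linarith

theorem IsProx.mem_subdifferential : σ⁻¹ • (lam - lb) ∈ subdifferential P.d lb := by
  rw [subdifferential, Set.mem_ofPred_eq, d_of_mem P hb.1]
  refine ⟨EReal.coe_ne_top _, EReal.coe_ne_bot _, fun η => ?_⟩
  by_cases hη : η ∈ box M N P.α
  · rw [d_of_mem P hη, ← EReal.coe_add, EReal.coe_le_coe_iff, inner_smul_left]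
    exact hb.dualQuad_add_le hH hη
  · rw [d_of_notMem P hη]
    exact le_top

/-- The subgradient inequality at `lb`, tested with the minimizer s, says that the angle at `lb`
between `lam` and s is not acute. -/
theorem IsProx.norm_sq_add_le (hα : 0 < P.α) (hσ : 0 < σ) {s : Fld M N}
    (hs : s ∈ P.dualSolutions) :
    ‖lb - s‖ ^ 2 + ‖lam - lb‖ ^ 2 ≤ ‖lam - s‖ ^ 2 := by
  rw [P.mem_dualSolutions_iff hα] at hs
  have h1 := hb.dualQuad_add_le hH hs.1
  have h2 := hs.2 lb hb.1
  have h3 : inner ℝ (lam - lb) (s - lb) ≤ 0 := by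
    by_contra! h
    linarith [mul_pos (inv_pos.2 hσ) h]
  have e : lam - s = (lam - lb) - (s - lb) := by abel
  rw [e, norm_sub_sq_real (lam - lb), norm_sub_rev lb s]
  linarith

/-- The inexactness of a minimizer of the augmented Lagrangian controls the distance of the
multiplier update to the proximal point. -/
theorem IsProx.gap (hα : 0 < P.α) (hσ : 0 < σ) (u' : Img M N) (p' : Fld M N) :
    1 / 2 * inner ℝ (P.H (u' - P.primalOf lb)) (u' - P.primalOf lb) +
        ‖lam + σ • (grad M N u' - p') - lb‖ ^ 2 / (2 * σ) ≤
      P.augLagrangian σ lam (pair u' p') - ⨅ x, P.augLagrangian σ lam x := by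
  set ub := P.primalOf lb with hub
  -- Chosen so that the multiplier update of (ub, pb) is exactly `lb`; the proximal inequality then
  -- makes pb normal to the box at `lb`, and (ub, pb) minimizes the augmented Lagrangian.
  set pb := grad M N ub + σ⁻¹ • (lam - lb) with hpb
  have hlb : lb = lam + σ • (grad M N (pair ub pb).fst - (pair ub pb).snd) := by
    rw [pair_fst, pair_snd, hpb, sub_add_cancel_left, smul_neg, smul_inv_smul₀ hσ.ne']
    abel
  have hn : inner ℝ pb lb = P.α * l1 pb := by
    refine inner_eq_l1 hα hb.1 fun η hη => ?_
    have := hb.2 η hη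
    rw [hpb, inner_add_left, inner_smul_left, ← neg_sub lb lam, inner_neg_left]
    simp only [conj_trivial]
    linarith
  have key : ∀ y : Pair M N, 1 / 2 * inner ℝ (P.H (y.fst - ub)) (y.fst - ub) +
      σ / 2 * ‖(grad M N y.fst - y.snd) - (grad M N ub - pb)‖ ^ 2 ≤
      P.augLagrangian σ lam y - P.augLagrangian σ lam (pair ub pb) := fun y => by
    rw [P.augLagrangian_sub (pair ub pb) y hlb, pair_fst, pair_snd]
    linarith [P.lagrangian_primalOf_add_le hH hb.1 hn y]
  -- `key` supplies the lower bound without which the real infimum would default to 0.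
  have hinf : ⨅ x, P.augLagrangian σ lam x ≤ P.augLagrangian σ lam (pair ub pb) := by
    refine ciInf_le ⟨P.augLagrangian σ lam (pair ub pb), ?_⟩ _
    rintro _ ⟨y, rfl⟩
    have h1 := key y
    have h2 := P.inner_H_self_nonneg hH (y.fst - ub)
    have h3 : 0 ≤ σ / 2 * ‖(grad M N y.fst - y.snd) - (grad M N ub - pb)‖ ^ 2 := by positivity
    linarith
  have h1 := key (pair u' p')
  have h2 : lam + σ • (grad M N u' - p') - lb =
      σ • ((grad M N u' - p') - (grad M N ub - pb)) := by
    rw [hpb, smul_sub σ (grad M N u' - p'), sub_add_cancel_left, smul_neg, smul_inv_smul₀ hσ.ne']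
    abel
  rw [h2, norm_smul, mul_pow, Real.norm_eq_abs, sq_abs]
  have h3 : σ ^ 2 * ‖(grad M N u' - p') - (grad M N ub - pb)‖ ^ 2 / (2 * σ) =
      σ / 2 * ‖(grad M N u' - p') - (grad M N ub - pb)‖ ^ 2 := by
    field_simp
  rw [h3]
  rw [pair_fst, pair_snd] at h1
  linarith

end Prox

end Problem

/-! ### Estimates for the linear rates -/

/-- One step of the linear convergence of the inexact proximal point iteration. -/
theorem infDist_le_rate_mul {E : Type*} [NormedAddCommGroup E] {S : Set E} (hS : S.Nonempty)
    {a a' b : E} {κ σ δ : ℝ} (hκ : 0 ≤ κ) (hσ : 0 < σ) (hδ0 : 0 ≤ δ) (hδ1 : δ < 1)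
    (ha : ‖a' - b‖ ≤ δ * ‖a' - a‖) (hb : Metric.infDist b S ≤ κ * (σ⁻¹ * ‖a - b‖))
    (hf : ∀ s ∈ S, ‖b - s‖ ^ 2 + ‖a - b‖ ^ 2 ≤ ‖a - s‖ ^ 2) :
    Metric.infDist a' S ≤ rate κ σ δ * Metric.infDist a S := by
  set x := Metric.infDist b S
  set y := Metric.infDist a S
  have hx0 : 0 ≤ x := Metric.infDist_nonneg
  have hy0 : 0 ≤ y := Metric.infDist_nonneg
  have hxy : √(x ^ 2 + ‖a - b‖ ^ 2) ≤ y := by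
    refine (Metric.le_infDist hS).2 fun s hs => ?_
    rw [dist_eq_norm]
    rw [Real.sqrt_le_left (norm_nonneg _)]
    have := pow_le_pow_left₀ hx0 (Metric.infDist_le_dist_of_mem (x := b) hs) 2
    rw [dist_eq_norm] at this
    linarith [hf s hs]
  have hxy2 : x ^ 2 + ‖a - b‖ ^ 2 ≤ y ^ 2 := (Real.sqrt_le_left hy0).1 hxy
  have hab : ‖a - b‖ ≤ y := le_of_sq_le_sq (by nlinarith) hy0
  have hR : 0 < √(κ ^ 2 + σ ^ 2) := Real.sqrt_pos.2 (by positivity)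
  -- With t = ‖a - b‖, σx ≤ κt and x² + t² ≤ y² give (κ² + σ²)x² ≤ κ²y².
  have hxθ : x ≤ κ / √(κ ^ 2 + σ ^ 2) * y := by
    rw [div_mul_eq_mul_div, le_div_iff₀ hR]
    refine le_of_sq_le_sq ?_ (by positivity)
    rw [mul_pow, Real.sq_sqrt (by positivity)]
    have h1 : σ * x ≤ κ * ‖a - b‖ := by
      calc σ * x ≤ σ * (κ * (σ⁻¹ * ‖a - b‖)) := by gcongr
        _ = _ := by field_simp
    have h2 : (σ * x) ^ 2 ≤ (κ * ‖a - b‖) ^ 2 := pow_le_pow_left₀ (by positivity) h1 2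
    nlinarith [mul_le_mul_of_nonneg_left hxy2 (sq_nonneg κ)]
  -- ‖a' - a‖ ≤ δ‖a' - a‖ + y, and the first term is absorbed on the left.
  have hD : ‖a' - a‖ ≤ y * (1 - δ)⁻¹ := by
    rw [← div_eq_mul_inv, le_div_iff₀ (by linarith)]
    have := norm_sub_le_norm_sub_add_norm_sub a' b a
    rw [norm_sub_rev b a] at this
    linarith
  have hinv : 1 ≤ (1 - δ)⁻¹ := (one_le_inv₀ (by linarith)).2 (by linarith)
  calc Metric.infDist a' S ≤ x + dist a' b := Metric.infDist_le_infDist_add_dist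
    _ ≤ κ / √(κ ^ 2 + σ ^ 2) * y + δ * (y * (1 - δ)⁻¹) := by
        rw [dist_eq_norm]
        gcongr
        exact ha.trans (by gcongr)
    _ ≤ κ / √(κ ^ 2 + σ ^ 2) * y * (1 - δ)⁻¹ + δ * (y * (1 - δ)⁻¹) := by
        exact add_le_add_left (le_mul_of_one_le_right (by positivity) hinv) _
    _ = rate κ σ δ * y := by rw [rate]; ring

theorem tendsto_rate {κ σinf : ℝ} {σ δ : ℕ → ℝ} (hσinf : 0 < σinf)
    (hσ : Tendsto σ atTop (𝓝 σinf)) (hδ : Tendsto δ atTop (𝓝 0)) :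
    Tendsto (fun k => rate κ (σ k) (δ k)) atTop (𝓝 (κ / √(κ ^ 2 + σinf ^ 2))) := by
  have hR : √(κ ^ 2 + σinf ^ 2) ≠ 0 := (Real.sqrt_pos.2 (by positivity)).ne'
  have h1 : Tendsto (fun k => √(κ ^ 2 + σ k ^ 2)) atTop (𝓝 √(κ ^ 2 + σinf ^ 2)) :=
    (tendsto_const_nhds.add (hσ.pow 2)).sqrt
  have h2 : Tendsto (fun k => (1 - δ k)⁻¹) atTop (𝓝 (1 - 0)⁻¹) :=
    (tendsto_const_nhds.sub hδ).inv₀ (by norm_num)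
  have := ((tendsto_const_nhds (x := κ)).div h1 hR |>.add hδ).mul h2
  simpa [rate] using this

theorem div_sqrt_lt_one {κ σ : ℝ} (hσ : 0 < σ) : κ / √(κ ^ 2 + σ ^ 2) < 1 := by
  have hR : 0 < √(κ ^ 2 + σ ^ 2) := Real.sqrt_pos.2 (by positivity)
  rw [div_lt_one hR]
  refine (le_abs_self κ).trans_lt ?_
  rw [← Real.sqrt_sq_eq_abs]
  exact Real.sqrt_lt_sqrt (sq_nonneg _) (by linarith [pow_pos hσ 2])

theorem norm_toLp_le {E F : Type*} [NormedAddCommGroup E] [NormedAddCommGroup F] (v : E) (w : F) :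
    ‖(WithLp.toLp 2 (v, w) : WithLp 2 (E × F))‖ ≤ ‖v‖ + ‖w‖ := by
  rw [WithLp.prod_norm_eq_of_L2, Real.sqrt_le_left (by positivity)]
  change ‖v‖ ^ 2 + ‖w‖ ^ 2 ≤ _
  nlinarith [norm_nonneg v, norm_nonneg w]

theorem norm_fst_sub_le_infDist {E F : Type*} [NormedAddCommGroup E] [NormedAddCommGroup F]
    {T : Set (WithLp 2 (E × F))} (hT : T.Nonempty) {z : E} (h : ∀ y ∈ T, y.fst = z)
    (x : WithLp 2 (E × F)) : ‖x.fst - z‖ ≤ Metric.infDist x T := by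
  refine (Metric.le_infDist hT).2 fun y hy => ?_
  have h1 := WithLp.dist_fst_le x y
  rwa [h y hy, dist_eq_norm] at h1

/-! ### Subgradients of the augmented Lagrangian and zeros of T_l -/

namespace Problem

variable {M N : ℕ} {Z : Type*} [NormedAddCommGroup Z] [InnerProductSpace ℝ Z]
  (P : Problem M N Z)

theorem mem_subdifferential_augLagrangian_iff {σ : ℝ} {lam : Fld M N} {x v : Pair M N} :
    v ∈ subdifferential (fun x => (P.augLagrangian σ lam x : EReal)) x ↔
      ∀ y, P.augLagrangian σ lam x + inner ℝ v (y - x) ≤ P.augLagrangian σ lam y := by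
  simp only [subdifferential, Set.mem_ofPred_eq, ← EReal.coe_add, EReal.coe_le_coe_iff]
  exact ⟨fun h => h.2.2, fun h => ⟨EReal.coe_ne_top _, EReal.coe_ne_bot _, h⟩⟩

theorem mem_Tl {x v : Pair M N} {l : Fld M N}
    (hv : ∀ y, P.lagrangian x l + inner ℝ v (y - x) ≤ P.lagrangian y l) :
    (WithLp.toLp 2 (v, -(grad M N x.fst - x.snd)) : Triple M N) ∈
      P.Tl (WithLp.toLp 2 (x, l)) := by
  refine ⟨hv, fun η => ?_⟩
  change P.lagrangian x η ≤
    P.lagrangian x l + inner ℝ (- -(grad M N x.fst - x.snd)) (η - l)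
  rw [neg_neg, inner_sub_right, lagrangian, lagrangian]
  linarith

variable [FiniteDimensional ℝ Z]

theorem exists_coercive (hH : ∀ u : Img M N, u ≠ 0 → 0 < inner ℝ (P.H u) u) :
    ∃ c > 0, ∀ u : Img M N, c * ‖u‖ ^ 2 ≤ inner ℝ (P.H u) u := by
  rcases subsingleton_or_nontrivial (Img M N) with h | h
  · exact ⟨1, one_pos, fun u => by simp [Subsingleton.elim u 0]⟩
  · have hcont : Continuous fun u => (inner ℝ (P.H u) u : ℝ) := by
      have : Continuous P.H := LinearMap.continuous_of_finiteDimensional _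
      fun_prop
    obtain ⟨x, hx, hmin⟩ := (isCompact_sphere (0 : Img M N) 1).exists_isMinOn
      (NormedSpace.sphere_nonempty.2 zero_le_one) hcont.continuousOn
    have hx0 : x ≠ 0 := by
      rintro rfl
      simp at hx
    refine ⟨_, hH x hx0, fun u => ?_⟩
    by_cases hu : u = 0
    · simp [hu]
    have hn : 0 < ‖u‖ := norm_pos_iff.2 hu
    have h1 : ‖u‖⁻¹ • u ∈ Metric.sphere (0 : Img M N) 1 := by
      rw [mem_sphere_zero_iff_norm, norm_smul, norm_inv, norm_norm, inv_mul_cancel₀ hn.ne']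
    have h2 := hmin h1
    simp only [Set.mem_ofPred_eq, map_smul, inner_smul_left, inner_smul_right, conj_trivial] at h2
    calc _ ≤ (‖u‖⁻¹ * (‖u‖⁻¹ * inner ℝ (P.H u) u)) * ‖u‖ ^ 2 := by gcongr
      _ = _ := by field_simp

theorem tendsto_zero_of_inner_H (hH : ∀ u : Img M N, u ≠ 0 → 0 < inner ℝ (P.H u) u)
    {e : ℕ → Img M N} (h : Tendsto (fun k => (inner ℝ (P.H (e k)) (e k) : ℝ)) atTop (𝓝 0)) :
    Tendsto e atTop (𝓝 0) := by
  obtain ⟨c, hc, hcoer⟩ := P.exists_coercive hH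
  have h1 : Tendsto (fun k => ‖e k‖ ^ 2) atTop (𝓝 0) := by
    refine squeeze_zero (fun _ => sq_nonneg _) (fun k => ?_) (by simpa using h.const_mul c⁻¹)
    rw [le_inv_mul_iff₀ hc]
    exact hcoer _
  rw [tendsto_zero_iff_norm_tendsto_zero]
  simpa [Real.sqrt_sq] using h1.sqrt

theorem lagrangian_add_smul_le (hH : ∀ u : Img M N, u ≠ 0 → 0 < inner ℝ (P.H u) u)
    (hα : 0 ≤ P.α) (x y : Pair M N) (l : Fld M N) {t : ℝ} (ht0 : 0 ≤ t) (ht1 : t ≤ 1) :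
    P.lagrangian (x + t • (y - x)) l ≤
      P.lagrangian x l + t * (P.lagrangian y l - P.lagrangian x l) := by
  have e1 : (x + t • (y - x)).fst = x.fst + t • (y.fst - x.fst) := rfl
  have e2 : (x + t • (y - x)).snd = (1 - t) • x.snd + t • y.snd := by
    change x.snd + t • (y.snd - x.snd) = _
    module
  have e3 : grad M N (x.fst + t • (y.fst - x.fst)) - ((1 - t) • x.snd + t • y.snd) =
      (1 - t) • (grad M N x.fst - x.snd) + t • (grad M N y.fst - y.snd) := by
    rw [map_add, map_smul, map_sub]
    module
  have h1 := l1_smul_add_smul_le (1 - t) t (by linarith) ht0 x.snd y.snd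
  have h2 := P.D_eq x.fst (x.fst + t • (y.fst - x.fst))
  have h3 := P.D_eq x.fst y.fst
  have h4 := P.inner_H_self_nonneg hH (y.fst - x.fst)
  rw [add_sub_cancel_left, map_smul, inner_smul_left, inner_smul_right, inner_smul_right] at h2
  simp only [conj_trivial] at h2
  rw [lagrangian, e1, e2, e3, inner_add_left, inner_smul_left, inner_smul_left, lagrangian,
    lagrangian]
  simp only [conj_trivial]
  have h5 := mul_le_mul_of_nonneg_left h1 hα
  have h6 : 0 ≤ t * (1 - t) * inner ℝ (P.H (y.fst - x.fst)) (y.fst - x.fst) :=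
    mul_nonneg (mul_nonneg ht0 (by linarith)) h4
  have h7 := congrArg (t * ·) h3
  linarith

section Subgradient

variable (hH : ∀ u : Img M N, u ≠ 0 → 0 < inner ℝ (P.H u) u) {σ : ℝ} {lam l : Fld M N}
  {x : Pair M N} (hl : l = lam + σ • (grad M N x.fst - x.snd))
include hH hl

/-- By `augLagrangian_sub` the two functions differ near x by a constant and O(t²), so they share
subgradients; convexity of the Lagrangian extends the inequality from small t to y. -/
theorem lagrangian_add_inner_le (hα : 0 ≤ P.α) {v : Pair M N}
    (hv : ∀ y, P.augLagrangian σ lam x + inner ℝ v (y - x) ≤ P.augLagrangian σ lam y)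
    (y : Pair M N) :
    P.lagrangian x l + inner ℝ v (y - x) ≤ P.lagrangian y l := by
  suffices h : 0 ≤ P.lagrangian y l - P.lagrangian x l - inner ℝ v (y - x) by linarith
  refine nonneg_of_forall_small
    (C := σ / 2 * ‖(grad M N y.fst - y.snd) - (grad M N x.fst - x.snd)‖ ^ 2)
    fun t ht0 ht1 => ?_
  have h1 := hv (x + t • (y - x))
  have h2 := P.augLagrangian_sub x (x + t • (y - x)) hl
  have h3 := P.lagrangian_add_smul_le hH hα x y l ht0.le ht1
  have e : grad M N (x + t • (y - x)).fst - (x + t • (y - x)).snd - (grad M N x.fst - x.snd) =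
      t • ((grad M N y.fst - y.snd) - (grad M N x.fst - x.snd)) := by
    change grad M N (x.fst + t • (y.fst - x.fst)) - (x.snd + t • (y.snd - x.snd)) - _ = _
    rw [map_add, map_smul, map_sub]
    module
  rw [e, norm_smul, mul_pow, Real.norm_eq_abs, sq_abs] at h2
  rw [add_sub_cancel_left, inner_smul_right] at h1
  linarith

/-- Needed because `Metric.infDist` to the empty set is 0, which would make (B2) void. The witness
is the u-gradient of the Lagrangian at `l`, paired with 0 since `l` ∈ α∂‖·‖₁(p). -/
theorem subdifferential_augLagrangian_nonempty (hσ : 0 ≤ σ) (hlb : l ∈ box M N P.α)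
    (hx : inner ℝ x.snd l = P.α * l1 x.snd) :
    (subdifferential (fun x => (P.augLagrangian σ lam x : EReal)) x).Nonempty := by
  refine ⟨pair (P.H x.fst - P.f - div M N l) 0,
    P.mem_subdifferential_augLagrangian_iff.2 fun y => ?_⟩
  have h1 := P.augLagrangian_sub x y hl
  have h2 : 0 ≤ σ / 2 * ‖(grad M N y.fst - y.snd) - (grad M N x.fst - x.snd)‖ ^ 2 := by
    positivity
  have h3 := P.D_eq x.fst y.fst
  have h4 := P.inner_H_self_nonneg hH (y.fst - x.fst)
  have h5 := inner_le_l1 y.snd hlb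
  have h6 : inner ℝ (pair (P.H x.fst - P.f - div M N l) 0) (y - x) =
      inner ℝ (P.H x.fst - P.f) (y.fst - x.fst) +
        (inner ℝ (grad M N y.fst) l - inner ℝ (grad M N x.fst) l) := by
    rw [WithLp.prod_inner_apply]
    change inner ℝ (P.H x.fst - P.f - div M N l) (y.fst - x.fst) +
      inner ℝ (0 : Fld M N) (y.snd - x.snd) = _
    rw [inner_zero_left, inner_sub_left (P.H x.fst - P.f), inner_div_left, ← inner_sub_left,
      ← map_sub, real_inner_comm l]
    ring
  rw [h6]
  simp only [lagrangian, inner_sub_left] at h1 h3 ⊢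
  linarith

end Subgradient

/-- Testing the concave inequality with λ shifted by r = ∇u - p gives ‖r‖² ≤ 0; then u minimizes the
primal objective, whose minimizer is unique. -/
theorem fst_eq_of_zero_mem_Tl (hH : ∀ u : Img M N, u ≠ 0 → 0 < inner ℝ (P.H u) u)
    (hα : 0 < P.α) {s : Fld M N} (hs : s ∈ P.dualSolutions) {x : Triple M N}
    (hx : 0 ∈ P.Tl x) :
    x.fst = pair (P.primalOf s) (grad M N (P.primalOf s)) := by
  obtain ⟨h1, h2⟩ := hx
  have hr : grad M N x.fst.fst - x.fst.snd = 0 := by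
    have h := h2 (x.snd + (grad M N x.fst.fst - x.fst.snd))
    simp only [WithLp.zero_snd, neg_zero, inner_zero_left, add_zero, lagrangian,
      inner_add_right] at h
    exact (real_inner_self_nonpos (F := Fld M N)).1 (by linarith : inner ℝ _ _ ≤ (0 : ℝ))
  have hp : x.fst.snd = grad M N x.fst.fst := (sub_eq_zero.1 hr).symm
  have hu : x.fst.fst = P.primalOf s := by
    refine P.eq_primalOf_of_primal_le hH hα hs ?_
    have h := h1 (pair (P.primalOf s) (grad M N (P.primalOf s)))
    simpa [lagrangian, hp, primal] using h
  change pair x.fst.fst x.fst.snd = _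
  rw [hp, hu]

end Problem

/-! ### Convergence and rates of the iterates -/

namespace IsALMSequence

variable {M N : ℕ} {Z : Type*} [NormedAddCommGroup Z] [InnerProductSpace ℝ Z]
  {P : Problem M N Z} {v : Variant} {σ : ℕ → ℝ} {σinf : ℝ}
  {u : ℕ → Img M N} {p lam : ℕ → Fld M N} (hseq : IsALMSequence P v σ σinf u p lam)
include hseq

theorem sigma_limit_pos : 0 < σinf :=
  (hseq.sigma_pos 0).trans_le (hseq.sigma_mono.ge_of_tendsto hseq.sigma_tendsto 0)

theorem lam_succ_eq_proj (hα : 0 < P.α) (k : ℕ) :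
    lam (k + 1) = proj P.α (lam k + σ k • grad M N (u (k + 1))) := by
  rw [hseq.lam_update, hseq.p_update, multiplierUpdate_eq P hα (hseq.sigma_pos k)]

theorem lam_succ (hα : 0 < P.α) (k : ℕ) :
    lam (k + 1) = lam k + σ k • (grad M N (u (k + 1)) - p (k + 1)) := by
  rw [hseq.lam_succ_eq_proj hα, proj_eq_sub_softThreshold hα (hseq.sigma_pos k), hseq.p_update]

theorem p_succ (hα : 0 < P.α) (k : ℕ) :
    p (k + 1) = grad M N (u (k + 1)) - (σ k)⁻¹ • (lam (k + 1) - lam k) := by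
  rw [hseq.lam_succ hα, add_sub_cancel_left, inv_smul_smul₀ (hseq.sigma_pos k).ne', sub_sub_cancel]

theorem inner_p_lam (hα : 0 < P.α) (k : ℕ) :
    inner ℝ (p (k + 1)) (lam (k + 1)) = P.α * l1 (p (k + 1)) := by
  rw [hseq.lam_succ_eq_proj hα, hseq.p_update, inner_softThreshold hα (hseq.sigma_pos k)]

variable [FiniteDimensional ℝ Z]

/-- The bound e is left free: it is ε_k under (A) and δ_k‖λ^{k+1} - λ^k‖ under (B1). -/
theorem norm_lam_succ_sub_le (hH : ∀ u : Img M N, u ≠ 0 → 0 < inner ℝ (P.H u) u)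
    (hα : 0 < P.α) {k : ℕ} {b : Fld M N} (hb : P.IsProx (σ k) (lam k) b) {e : ℝ} (he : 0 ≤ e)
    (hgap : subproblemGap P σ u p lam k ≤ e ^ 2 / (2 * σ k)) :
    ‖lam (k + 1) - b‖ ≤ e := by
  have hσ := hseq.sigma_pos k
  have h := hb.gap hH hα hσ (u (k + 1)) (p (k + 1))
  rw [← hseq.lam_succ hα k] at h
  have h1 := P.inner_H_self_nonneg hH (u (k + 1) - P.primalOf b)
  refine le_of_sq_le_sq ?_ he
  rw [← div_le_div_iff_of_pos_right (by positivity : 0 < 2 * σ k)]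
  unfold subproblemGap at hgap
  linarith

/-- The proximal points of the multipliers, and the convergence of the iterates under
criterion (A). -/
theorem exists_limit (hH : ∀ u : Img M N, u ≠ 0 → 0 < inner ℝ (P.H u) u)
    (hα : 0 < P.α) {ε : ℕ → ℝ} (hA : StopA P σ u p lam ε) :
    ∃ s ∈ P.dualSolutions, ∃ b : ℕ → Fld M N, (∀ k, P.IsProx (σ k) (lam k) (b k)) ∧
      Tendsto lam atTop (𝓝 s) ∧ Tendsto b atTop (𝓝 s) ∧
      Tendsto u atTop (𝓝 (P.primalOf s)) ∧
      Tendsto p atTop (𝓝 (grad M N (P.primalOf s))) := by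
  obtain ⟨hε0, hε, hgap⟩ := hA
  choose b hb using fun k => P.exists_isProx hH hα (σ := σ k) (lam k)
  have hσinv : Tendsto (fun k => (σ k)⁻¹) atTop (𝓝 σinf⁻¹) :=
    hseq.sigma_tendsto.inv₀ hseq.sigma_limit_pos.ne'
  obtain ⟨s, hs, hlam, hbs⟩ := exists_tendsto_of_fejer (a := lam) (b := b) (e := ε)
    (P.dualSolutions_nonempty hα) hε hε0
    (fun k => hseq.norm_lam_succ_sub_le hH hα (hb k) (hε0 k) (hgap k))
    (fun s hs k => (hb k).norm_sq_add_le hH hα (hseq.sigma_pos k) hs)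
    (fun φ x hφ hax hbx => by
      rw [P.mem_dualSolutions_iff hα]
      refine ⟨(isClosed_box P.α).mem_of_tendsto hbx (Eventually.of_forall fun k => (hb _).1),
        fun η hη => ?_⟩
      have h1 : Tendsto (fun k => P.dualQuad (b (φ k)) + (σ (φ k))⁻¹ *
          inner ℝ (lam (φ k) - b (φ k)) (η - b (φ k))) atTop
          (𝓝 (P.dualQuad x + σinf⁻¹ * inner ℝ (x - x) (η - x))) :=
        ((P.continuous_dualQuad.tendsto x).comp hbx).add
          ((hσinv.comp hφ.tendsto_atTop).mul ((hax.sub hbx).inner (hbx.const_sub η)))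
      rw [sub_self, inner_zero_left, mul_zero, add_zero] at h1
      exact le_of_tendsto h1 (Eventually.of_forall fun k => (hb _).dualQuad_add_le hH hη))
  have he : Tendsto (fun k => u (k + 1) - P.primalOf (b k)) atTop (𝓝 0) := by
    refine P.tendsto_zero_of_inner_H hH ?_
    have h1 : Tendsto (fun k => ε k ^ 2 * (σ k)⁻¹) atTop (𝓝 0) := by
      simpa using (hε.tendsto_atTop_zero.pow 2).mul hσinv
    refine squeeze_zero (fun k => P.inner_H_self_nonneg hH _) (fun k => ?_) h1
    have hσ := hseq.sigma_pos k
    have h2 := (hb k).gap hH hα hσ (u (k + 1)) (p (k + 1))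
    have h3 := hgap k
    unfold subproblemGap at h3
    have h4 : 0 ≤ ‖lam k + σ k • (grad M N (u (k + 1)) - p (k + 1)) - b k‖ ^ 2 / (2 * σ k) := by
      positivity
    have h5 : ε k ^ 2 / (2 * σ k) = 1 / 2 * (ε k ^ 2 * (σ k)⁻¹) := by field_simp
    linarith
  have hu : Tendsto (fun k => u (k + 1)) atTop (𝓝 (P.primalOf s)) := by
    have := he.add ((P.continuous_primalOf.tendsto s).comp hbs)
    simpa using this
  have hp : Tendsto (fun k => p (k + 1)) atTop (𝓝 (grad M N (P.primalOf s))) := by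
    have hg : Continuous (grad M N) := LinearMap.continuous_of_finiteDimensional _
    have h1 := ((hg.tendsto _).comp hu).sub
      (hσinv.smul (((tendsto_add_atTop_iff_nat 1).2 hlam).sub hlam))
    rw [sub_self, smul_zero, sub_zero] at h1
    exact h1.congr fun k => (hseq.p_succ hα k).symm
  exact ⟨s, hs, b, hb, hlam, hbs, (tendsto_add_atTop_iff_nat 1).1 hu,
    (tendsto_add_atTop_iff_nat 1).1 hp⟩

/-- Linear convergence of the multipliers. -/
theorem eventually_infDist_le (hH : ∀ u : Img M N, u ≠ 0 → 0 < inner ℝ (P.H u) u)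
    (hα : 0 < P.α) {s : Fld M N} {b : ℕ → Fld M N} (hb : ∀ k, P.IsProx (σ k) (lam k) (b k))
    (hlam : Tendsto lam atTop (𝓝 s)) (hbs : Tendsto b atTop (𝓝 s)) {κ : ℝ} {δ : ℕ → ℝ}
    (hsub : IsMetricallySubregularAt (subdifferential P.d) s 0 κ)
    (hB : StopB1 P σ u p lam δ) :
    ∀ᶠ k in atTop, Metric.infDist (lam (k + 1)) P.dualSolutions ≤
      rate κ (σ k) (δ k) * Metric.infDist (lam k) P.dualSolutions := by
  obtain ⟨hδ0, hδ, hgap⟩ := hB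
  obtain ⟨hκ, -, U, hU, V, hV, hUV⟩ := hsub
  rw [P.setOf_zero_mem_subdifferential_d hα] at hUV
  -- Subregularity is applied at b k with this subgradient, which must eventually lie in V.
  have hw : Tendsto (fun k => (σ k)⁻¹ • (lam k - b k)) atTop (𝓝 0) := by
    have := (hseq.sigma_tendsto.inv₀ hseq.sigma_limit_pos.ne').smul (hlam.sub hbs)
    rwa [sub_self, smul_zero] at this
  filter_upwards [hbs hU, hw hV, hδ.tendsto_atTop_zero.eventually_lt_const one_pos]
    with k hk1 hk2 hk3
  have hσ := hseq.sigma_pos k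
  refine infDist_le_rate_mul (P.dualSolutions_nonempty hα) hκ hσ (hδ0 k) hk3
    (hseq.norm_lam_succ_sub_le hH hα (hb k) (mul_nonneg (hδ0 k) (norm_nonneg _)) ?_) ?_
    (fun s hs => (hb k).norm_sq_add_le hH hα hσ hs)
  · rw [mul_pow, mul_div_right_comm]
    exact hgap k
  · have := hUV _ hk1 _ ⟨(hb k).mem_subdifferential hH, hk2⟩
    rwa [dist_zero_left, norm_smul, norm_inv, Real.norm_eq_abs, abs_of_pos hσ] at this

/-- Convergence of the primal iterates at the speed of the multipliers. -/
theorem eventually_norm_pair_sub_le (hH : ∀ u : Img M N, u ≠ 0 → 0 < inner ℝ (P.H u) u)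
    (hα : 0 < P.α) {s : Fld M N} (hs : s ∈ P.dualSolutions) (hlam : Tendsto lam atTop (𝓝 s))
    (hx : Tendsto (fun k => triple (u k) (p k) (lam k)) atTop
      (𝓝 (triple (P.primalOf s) (grad M N (P.primalOf s)) s))) {κ : ℝ} {δ : ℕ → ℝ}
    (hsub : IsMetricallySubregularAt P.Tl
      (triple (P.primalOf s) (grad M N (P.primalOf s)) s) 0 κ)
    (hB : StopB2 P σ u p lam δ) :
    ∀ᶠ k in atTop,
      ‖pair (u (k + 1)) (p (k + 1)) - pair (P.primalOf s) (grad M N (P.primalOf s))‖ ≤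
        κ * (1 + δ k) / σ k * ‖lam (k + 1) - lam k‖ := by
  obtain ⟨hδ0, hδ, hdist⟩ := hB
  obtain ⟨hκ, h0, U, hU, V, hV, hUV⟩ := hsub
  have hzero : {x' | 0 ∈ P.Tl x'}.Nonempty := ⟨_, h0⟩
  obtain ⟨ρ, hρ, hρV⟩ := Metric.mem_nhds_iff.1 hV
  have hw : Tendsto (fun k => (1 + δ k) / σ k * ‖lam (k + 1) - lam k‖) atTop (𝓝 0) := by
    have h1 := ((hδ.const_add 1).div hseq.sigma_tendsto hseq.sigma_limit_pos.ne').mul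
      (((tendsto_add_atTop_iff_nat 1).2 hlam).sub hlam).norm
    rwa [sub_self, norm_zero, mul_zero] at h1
  filter_upwards [(tendsto_add_atTop_iff_nat 1).2 hx hU, hw.eventually_lt_const hρ] with k hk1 hk2
  have hσ := hseq.sigma_pos k
  set x := pair (u (k + 1)) (p (k + 1)) with hxdef
  set B := (1 + δ k) / σ k * ‖lam (k + 1) - lam k‖ with hBdef
  have hl : lam (k + 1) = lam k + σ k • (grad M N x.fst - x.snd) := hseq.lam_succ hα k
  have hbox : lam (k + 1) ∈ box M N P.α := by
    rw [hseq.lam_succ_eq_proj hα]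
    exact proj_mem_box hα _
  have hne := P.subdifferential_augLagrangian_nonempty hH hl hσ.le hbox (hseq.inner_p_lam hα k)
  have hr : ‖grad M N x.fst - x.snd‖ = (σ k)⁻¹ * ‖lam (k + 1) - lam k‖ := by
    rw [hl, add_sub_cancel_left, norm_smul, Real.norm_eq_abs, abs_of_pos hσ,
      inv_mul_cancel_left₀ hσ.ne']
  -- The definition of the infimum only gives subgradients with norm close to the distance, so some
  -- slack B' > B is kept and then sent to B.
  suffices h : ∀ B' ∈ Set.Ioo B ρ,
      ‖x - pair (P.primalOf s) (grad M N (P.primalOf s))‖ ≤ κ * B' by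
    have h1 : Tendsto (fun B' => κ * B') (𝓝[>] B) (𝓝 (κ * B)) :=
      ((continuous_const_mul κ).tendsto B).mono_left nhdsWithin_le_nhds
    rw [mul_div_assoc, mul_assoc]
    refine ge_of_tendsto h1 ?_
    filter_upwards [Ioo_mem_nhdsGT hk2] with B' hB' using h B' hB'
  rintro B' ⟨hB1, hB2⟩
  -- The residual ∇u - p uses up σ_k⁻¹‖λ^{k+1} - λ^k‖ of B'; the rest is left for v.
  obtain ⟨v, hv, hv'⟩ := (Metric.infDist_lt_iff hne
    (r := B' - (σ k)⁻¹ * ‖lam (k + 1) - lam k‖)).1 (by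
      refine (hdist k).trans_lt ?_
      have : B = (σ k)⁻¹ * ‖lam (k + 1) - lam k‖ + δ k / σ k * ‖lam (k + 1) - lam k‖ := by
        rw [hBdef]; ring
      linarith)
  rw [dist_zero_left] at hv'
  have hT : (WithLp.toLp 2 (v, -(grad M N x.fst - x.snd)) : Triple M N) ∈
      P.Tl (triple (u (k + 1)) (p (k + 1)) (lam (k + 1))) := P.mem_Tl (P.lagrangian_add_inner_le hH hl hα.le
    (P.mem_subdifferential_augLagrangian_iff.1 hv))
  have hn := norm_toLp_le v (-(grad M N x.fst - x.snd))
  rw [norm_neg, hr] at hn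
  have hTV : (WithLp.toLp 2 (v, -(grad M N x.fst - x.snd)) : Triple M N) ∈ V := by
    refine hρV ?_
    rw [mem_ball_zero_iff]
    linarith
  have hle := hUV (triple (u (k + 1)) (p (k + 1)) (lam (k + 1))) hk1 _ ⟨hT, hTV⟩
  rw [dist_zero_left] at hle
  calc ‖x - pair (P.primalOf s) (grad M N (P.primalOf s))‖
      ≤ Metric.infDist (triple (u (k + 1)) (p (k + 1)) (lam (k + 1))) {x' | 0 ∈ P.Tl x'} :=
        norm_fst_sub_le_infDist hzero (fun y hy => P.fst_eq_of_zero_mem_Tl hH hα hs hy)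
          (triple (u (k + 1)) (p (k + 1)) (lam (k + 1)))
    _ ≤ _ := hle
    _ ≤ κ * B' := by
        gcongr
        linarith

end IsALMSequence

end TV

end

theorem mainTheorem3 {M N : ℕ} {Z : Type*} [NormedAddCommGroup Z] [InnerProductSpace ℝ Z]
    [FiniteDimensional ℝ Z] (P : TV.Problem M N Z) (hμ : 0 ≤ P.μ) (hα : 0 < P.α)
    (hH : ∀ u : TV.Img M N, u ≠ 0 → 0 < inner ℝ (P.H u) u)
    (v : TV.Variant) (σ : ℕ → ℝ) (σinf : ℝ)
    (u : ℕ → TV.Img M N) (p lam : ℕ → TV.Fld M N) (ε : ℕ → ℝ)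
    (hseq : TV.IsALMSequence P v σ σinf u p lam) (hA : TV.StopA P σ u p lam ε) :
    Bornology.IsBounded (Set.range fun k => TV.triple (u k) (p k) (lam k)) ∧
    ∃ (ustar : TV.Img M N) (pstar lamstar : TV.Fld M N),
      (∀ w, P.primal ustar ≤ P.primal w) ∧
      pstar = TV.grad M N ustar ∧
      lamstar ∈ P.dualSolutions ∧
      Tendsto (fun k => TV.triple (u k) (p k) (lam k)) atTop
        (𝓝 (TV.triple ustar pstar lamstar)) ∧
      ∀ (κd : ℝ) (δ : ℕ → ℝ),
        TV.IsMetricallySubregularAt (TV.subdifferential P.d) lamstar 0 κd →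
        TV.StopB1 P σ u p lam δ →
        (∀ᶠ k in atTop, Metric.infDist (lam (k + 1)) P.dualSolutions ≤
            TV.rate κd (σ k) (δ k) * Metric.infDist (lam k) P.dualSolutions) ∧
        Tendsto (fun k => TV.rate κd (σ k) (δ k)) atTop (𝓝 (κd / √(κd ^ 2 + σinf ^ 2))) ∧
        κd / √(κd ^ 2 + σinf ^ 2) < 1 ∧
        ∀ (κl : ℝ) (δ' : ℕ → ℝ),
          TV.IsMetricallySubregularAt P.Tl (TV.triple ustar pstar lamstar) 0 κl →
          TV.StopB2 P σ u p lam δ' →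
          (∀ᶠ k in atTop,
            ‖TV.pair (u (k + 1)) (p (k + 1)) - TV.pair ustar pstar‖ ≤
              κl * (1 + δ' k) / σ k * ‖lam (k + 1) - lam k‖) ∧
          Tendsto (fun k => κl * (1 + δ' k) / σ k) atTop (𝓝 (κl / σinf)) := by
  obtain ⟨s, hs, b, hb, hlam, hbs, hu, hp⟩ := hseq.exists_limit hH hα hA
  have hx : Tendsto (fun k => TV.triple (u k) (p k) (lam k)) atTop
      (𝓝 (TV.triple (P.primalOf s) (TV.grad M N (P.primalOf s)) s)) := by
    have h1 : Continuous fun x : (TV.Img M N × TV.Fld M N) × TV.Fld M N =>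
        TV.triple x.1.1 x.1.2 x.2 := by
      unfold TV.triple TV.pair
      fun_prop
    exact (h1.tendsto ((_, _), _)).comp ((hu.prodMk_nhds hp).prodMk_nhds hlam)
  refine ⟨Metric.isBounded_range_of_tendsto _ hx, P.primalOf s, _, s, fun w => ?_, rfl, hs, hx,
    fun κd δ hd hB1 => ⟨hseq.eventually_infDist_le hH hα hb hlam hbs hd hB1,
      TV.tendsto_rate hseq.sigma_limit_pos hseq.sigma_tendsto hB1.2.1.tendsto_atTop_zero,
      TV.div_sqrt_lt_one hseq.sigma_limit_pos,
      fun κl δ' hl hB2 => ⟨hseq.eventually_norm_pair_sub_le hH hα hs hlam hx hl hB2, ?_⟩⟩⟩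
  · linarith [P.primal_primalOf_add_le hH hα hs w,
      P.inner_H_self_nonneg hH (w - P.primalOf s)]
  · have h := (hB2.2.1.const_add 1).const_mul κl
    rw [add_zero, mul_one] at h
    exact h.div hseq.sigma_tendsto hseq.sigma_limit_pos.ne'
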